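/- Let $n\ge 2$. For a domain (nonempty connected open set) $D\subset\mathbb C^n$, let $l_D(z,w)=\inf\{\tanh^{-1}|\alpha|\}$, where the infimum is over all $\alpha$ in the open unit disc $\mathbb D\subset\mathbb C$ for which there is a holomorphic map $\varphi:\mathbb D\to D$ with $\varphi(0)=z$ and $\varphi(\alpha)=w$, and let the Kobayashi distance $k_D$ be the largest pseudodistance on $D$ not exceeding $l_D$. Two distances $d_1,d_2$ on a set $X$ are called quasi-isometrically equivalent if there are constants $c_1,c_2>0$ such that $c_1^{-1}d_1(x,y)-c_2\le d_2(x,y)\le c_1d_1(x,y)+c_2$ for all $x,y\in X$. A metric space $(X,d)$ is called Gromov hyperbolic if, with $(x,y)_z=d(x,z)+d(z,y)-d(x,y)$, $$\sup_{p,q,x,w\in X}\bigl(\min\{(p,x)_w,(x,q)_w\}-(p,q)_w\bigr)<\infty .$$ Let $G\subset\mathbb C^n$ be a bounded domain and let $K$ be a compact subset of $G$ such that through any point $z\in\mathbb C^n\setminus K$ passes a complex line disjoint from $K$. Then $G\setminus K$ is a domain, $k_{G\setminus K}$ and the restriction of $k_G$ to $G\setminus K$ are distances on $G\setminus K$, and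 they are quasi-isometrically equivalent. In particular, if $(G,k_G)$ is Gromov hyperbolic, then so is $(G\setminus K,k_{G\setminus K})$. Moreover, the hypothesis on complex lines holds for every compact convex set $K\subset\mathbb C^n$. -/

import Mathlib

open scoped ENNReal

noncomputable section

/-- The complex Euclidean space of dimension `n`. -/
abbrev Cn (n : ℕ) : Type := EuclideanSpace ℂ (Fin n)

/-- A domain: a nonempty, connected, open set. -/
def IsDomainSet {n : ℕ} (D : Set (Cn n)) : Prop :=
  IsOpen D ∧ IsConnected D

/-- Through any point outside `K` passes a complex line (a complex affine subspace of complex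
dimension one) that is disjoint from `K`. -/
def LinesAvoid {n : ℕ} (K : Set (Cn n)) : Prop :=
  ∀ z : Cn n, z ∉ K → ∃ L : AffineSubspace ℂ (Cn n),
    z ∈ L ∧ Module.finrank ℂ L.direction = 1 ∧ Disjoint (L : Set (Cn n)) K

/-- The Lempert function of `D`: the infimum of `artanh |α|` over all `α` in the unit disc for which
there is a holomorphic map `φ` from the unit disc to `D` with `φ 0 = z` and `φ α = w`
(infinite if there is no such `α`). -/
def lempert {n : ℕ} (D : Set (Cn n)) (z w : Cn n) : ℝ≥0∞ :=
  ⨅ (α : ℂ) (_ : α ∈ Metric.ball (0 : ℂ) 1)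
    (_ : ∃ φ : ℂ → Cn n, DifferentiableOn ℂ φ (Metric.ball 0 1) ∧
      Set.MapsTo φ (Metric.ball 0 1) D ∧ φ 0 = z ∧ φ α = w),
    ENNReal.ofReal (Real.artanh ‖α‖)

/-- The largest `[0, ∞]`-valued pseudodistance on `D` that does not exceed the Lempert function. -/
def kobayashiE {n : ℕ} (D : Set (Cn n)) (z w : D) : ℝ≥0∞ :=
  ⨆ (d : PseudoMetric D ℝ≥0∞) (_ : ∀ x y : D, d x y ≤ lempert D x y), d z w

/-- The Kobayashi (pseudo)distance of `D`, as a real number. (The value `kobayashiE D z w` is finite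
when `D` is a domain. Below, `IsDistance` excludes the value `∞` for the functions it is applied
to, since `∞` would be sent to `0`.) -/
def kobayashi {n : ℕ} (D : Set (Cn n)) (z w : D) : ℝ :=
  (kobayashiE D z w).toReal

/-- `d` is a distance: `(X, d)` is a metric space. -/
structure IsDistance {X : Type*} (d : X → X → ℝ) : Prop where
  nonneg : ∀ x y, 0 ≤ d x y
  eq_zero_iff : ∀ x y, d x y = 0 ↔ x = y
  symm : ∀ x y, d x y = d y x
  triangle : ∀ x y z, d x z ≤ d x y + d y z

/-- The map `φ` from the metric space `(X₁, d₁)` to the metric space `(X₂, d₂)` is a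
quasi-isometry. -/
def IsQuasiIsometry {X₁ X₂ : Type*} (d₁ : X₁ → X₁ → ℝ) (d₂ : X₂ → X₂ → ℝ) (φ : X₁ → X₂) : Prop :=
  IsDistance d₁ ∧ IsDistance d₂ ∧ ∃ c₁ c₂ : ℝ, 0 < c₁ ∧ 0 < c₂ ∧ ∀ x y : X₁,
    c₁⁻¹ * d₁ x y - c₂ ≤ d₂ (φ x) (φ y) ∧ d₂ (φ x) (φ y) ≤ c₁ * d₁ x y + c₂

/-- Two distances on `X` are quasi-isometrically equivalent. -/
def QuasiIsometricallyEquivalent {X : Type*} (d₁ d₂ : X → X → ℝ) : Prop :=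
  IsQuasiIsometry d₁ d₂ id

/-- The Gromov product `(x, y)_z` (in the normalization without the factor `1 / 2`). -/
def gromovProduct {X : Type*} (d : X → X → ℝ) (x y z : X) : ℝ :=
  d x z + d z y - d x y

/-- The metric space `(X, d)` is Gromov hyperbolic: the supremum of
`min {(p, x)_w, (x, q)_w} - (p, q)_w` over all `p, q, x, w` is finite. -/
def GromovHyperbolic {X : Type*} (d : X → X → ℝ) : Prop :=
  IsDistance d ∧ ∃ C : ℝ, ∀ p q x w : X,
    min (gromovProduct d p x w) (gromovProduct d x q w) - gromovProduct d p q w ≤ C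

end

/-!
`G \ K` is connected because `ℂⁿ` is unicoherent and the avoiding lines join every point outside `K`
to infinity. The Kobayashi distance is the infimum of the lengths of chains of holomorphic discs,
and the point is that `k_(G \ K) ≤ k_G + C`. Walking along avoiding lines shows that points of
`G \ K` near `K` are at bounded distance from each other, so a neighbourhood of `K` may be collapsed
to a point. Away from `K`, a disc whose centre is at `k_G`-distance `s` from `K` avoids `K` after
shrinking it by the factor `tanh s`, which lengthens a small step of length `h` by only
`O(h * exp (-2 * s))`. Along a nearly minimal chain `s` decreases and then increases at unit speed,
up to bounded errors, so the total excess is bounded by the integral of `exp (-2 * |t|)`.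
-/

open Metric Set

section Unicoherence

variable {X : Type*} [TopologicalSpace X]

theorem exists_continuous_lift_addCircle [SimplyConnectedSpace X] [LocallyPathConnectedSpace X]
    {F : X → AddCircle (1 : ℝ)} (hF : Continuous F) :
    ∃ g : X → ℝ, Continuous g ∧ ∀ x, (g x : AddCircle (1 : ℝ)) = F x := by
  have x₀ : X := Classical.arbitrary X
  obtain ⟨t, ht⟩ := QuotientAddGroup.mk_surjective (F x₀)
  obtain ⟨g, ⟨-, hg⟩, -⟩ :=
    (AddCircle.isCoveringMap_coe (1 : ℝ)).existsUnique_continuousMap_lifts ⟨F, hF⟩ x₀ t ht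
  exact ⟨g, g.continuous, congrFun hg⟩

theorem sub_eq_sub_of_coe_addCircle_eq {W : Set X} (hW : IsPreconnected W) {f g : X → ℝ}
    (hf : ContinuousOn f W) (hg : ContinuousOn g W)
    (hfg : ∀ x ∈ W, (f x : AddCircle (1 : ℝ)) = g x) {p q : X} (hp : p ∈ W) (hq : q ∈ W) :
    f p - g p = f q - g q := by
  have hdiscrete : IsDiscrete (range ((↑) : ℤ → ℝ)) :=
    ⟨Int.isClosedEmbedding_coe_real.isEmbedding.toHomeomorph.symm.isEmbedding.discreteTopology⟩
  have hint : MapsTo (fun x => f x - g x) W (range ((↑) : ℤ → ℝ)) := fun x hx => by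
    have h0 : ((f x - g x : ℝ) : AddCircle (1 : ℝ)) = 0 := by
      rw [AddCircle.coe_sub, hfg x hx, sub_self]
    obtain ⟨m, hm⟩ := (AddCircle.coe_eq_zero_iff _).1 h0
    exact ⟨m, by simpa using hm⟩
  obtain ⟨c, -, hc⟩ := hW.eqOn_const_of_mapsTo hdiscrete (hf.sub hg) hint ⟨0, 0, by simp⟩
  exact (hc hp).trans (hc hq).symm

theorem disjoint_frontier_of_subset_union {A B S : Set X} (hA : IsOpen A) (hB : IsOpen B)
    (hAB : Disjoint A B) (hS : S ⊆ A ∪ B) : Disjoint (frontier A) S := by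
  rw [Set.disjoint_left]
  intro x hx hxS
  rcases hS hxS with hxA | hxB
  · exact (hA.frontier_eq ▸ hx).2 hxA
  · exact Set.disjoint_left.1 (hAB.closure_left hB) (frontier_subset_closure hx) hxB

/- If `A ⊔ B` were a splitting of `U ∩ V`, a function rising from `0` off `V` to `1` off `U`,
restricted to `A`, would descend to a map to the circle which winds once around the cycle running
through `A`, `V`, `B` and `U`; such a map has no lift to `ℝ`. -/
theorem isPreconnected_inter_of_union_eq_univ [NormalSpace X] [SimplyConnectedSpace X]
    [LocallyPathConnectedSpace X] {U V : Set X} (hU : IsOpen U) (hV : IsOpen V)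
    (hUc : IsPreconnected U) (hVc : IsPreconnected V) (hUV : U ∪ V = univ) :
    IsPreconnected (U ∩ V) := by
  classical
  rintro u v hu hv huv ⟨p, hpUV, hpu⟩ ⟨q, hqUV, hqv⟩
  by_contra hempty
  let A : Set X := U ∩ V ∩ u
  have hAB : Disjoint A (U ∩ V ∩ v) :=
    Set.disjoint_left.2 fun x hxA hxB => hempty ⟨x, hxA.1, hxA.2, hxB.2⟩
  have hfrontier : ∀ x ∈ frontier A, x ∉ U ∩ V := fun _ hx =>
    Set.disjoint_left.1 (disjoint_frontier_of_subset_union ((hU.inter hV).inter hu)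
      ((hU.inter hV).inter hv) hAB fun _ hy => (huv hy).imp (.intro hy) (.intro hy)) hx
  obtain ⟨h, h0, h1, -⟩ := exists_continuous_zero_one_of_isClosed hV.isClosed_compl
    hU.isClosed_compl (disjoint_compl_left_iff_subset.2 fun x hx =>
      (hUV ▸ mem_univ x : x ∈ U ∪ V).resolve_left hx)
  have hF : Continuous fun x => if x ∈ A then (h x : AddCircle (1 : ℝ)) else 0 := by
    refine Continuous.if (fun x hx => ?_) (by fun_prop) continuous_const
    by_cases hxU : x ∈ U
    · simp [h0 fun hxV => hfrontier x hx ⟨hxU, hxV⟩]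
    · rw [h1 hxU]
      exact AddCircle.coe_period 1
  obtain ⟨g, hg, hgF⟩ := exists_continuous_lift_addCircle hF
  have hcompare : ∀ (W : Set X) (a : ℝ), (a : AddCircle (1 : ℝ)) = 0 → IsPreconnected W →
      (∀ x ∈ W ∩ frontier A, h x = a) → p ∈ W → q ∈ W → g p - h p = g q - a := by
    intro W a ha hW hWA hp hq
    have hcont : ContinuousOn (fun x => if x ∈ A then h x else a) W :=
      ContinuousOn.if hWA (by fun_prop) continuousOn_const
    have hpA : p ∈ A := ⟨hpUV, hpu⟩
    have hqA : q ∉ A := fun hqA => Set.disjoint_left.1 hAB hqA ⟨hqUV, hqv⟩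
    simpa only [hpA, hqA, if_true, if_false] using
      sub_eq_sub_of_coe_addCircle_eq hW hg.continuousOn hcont
        (fun x _ => by rw [hgF]; split_ifs <;> simp [ha]) hp hq
  have hpqU := hcompare U 0 (by simp) hUc
    (fun x hx => h0 fun hxV => hfrontier x hx.2 ⟨hx.1, hxV⟩) hpUV.1 hqUV.1
  have hpqV := hcompare V 1 (AddCircle.coe_period 1) hVc
    (fun x hx => h1 fun hxU => hfrontier x hx.2 ⟨hxU, hx.1⟩) hpUV.2 hqUV.2
  linarith

end Unicoherence

theorem isPreconnected_compl_ball {E : Type*} [NormedAddCommGroup E] [NormedSpace ℝ E]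
    (hE : 1 < Module.rank ℝ E) {r : ℝ} (hr : 0 < r) : IsPreconnected (ball (0 : E) r)ᶜ := by
  have himage : (ball (0 : E) r)ᶜ = (fun p : ℝ × E => p.1 • p.2) '' (Ici r ×ˢ sphere 0 1) := by
    ext x
    simp only [mem_compl_iff, mem_ball_zero_iff, not_lt, mem_image, mem_prod, mem_Ici,
      mem_sphere_zero_iff_norm, Prod.exists]
    constructor
    · intro hx
      have hx0 : ‖x‖ ≠ 0 := (hr.trans_le hx).ne'
      exact ⟨‖x‖, ‖x‖⁻¹ • x, ⟨hx, by simp [norm_smul, hx0]⟩, smul_inv_smul₀ hx0 x⟩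
    · rintro ⟨a, y, ⟨ha, hy⟩, rfl⟩
      simpa [norm_smul, hy] using ha.trans (le_abs_self a)
  rw [himage]
  exact (isPreconnected_Ici.prod (isPreconnected_sphere hE 0 1)).image _ (by fun_prop)

section LinesEscape

variable {E : Type*} [NormedAddCommGroup E] [NormedSpace ℂ E] {G K : Set E}

/-- Through any point outside `K` passes a complex line disjoint from `K`: the condition
`LinesAvoid` for an arbitrary normed space, in terms of unit direction vectors. -/
def LinesEscape (K : Set E) : Prop :=
  ∀ z ∉ K, ∃ u : E, ‖u‖ = 1 ∧ ∀ c : ℂ, z + c • u ∉ K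

theorem LinesEscape.isPreconnected_compl (hE : 1 < Module.rank ℝ E)
    (hK : Bornology.IsBounded K) (hL : LinesEscape K) : IsPreconnected Kᶜ := by
  obtain ⟨r, hr, hKr⟩ := hK.subset_ball_lt 0 0
  have : Nontrivial E := rank_pos_iff_nontrivial.1 (zero_lt_one.trans hE)
  obtain ⟨p, hp⟩ := NormedSpace.exists_lt_norm ℝ E r
  refine isPreconnected_of_forall p fun z hz => ?_
  obtain ⟨u, hu, hKu⟩ := hL z hz
  have hline : IsPreconnected (range fun c : ℂ => z + c • u) := isPreconnected_range (by fun_prop)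
  have hfar : z + ((r + ‖z‖ : ℝ) : ℂ) • u ∈ (ball (0 : E) r)ᶜ := by
    have hnorm : ‖((r + ‖z‖ : ℝ) : ℂ) • u‖ = r + ‖z‖ := by
      rw [norm_smul, hu, Complex.norm_real, Real.norm_of_nonneg (by positivity), mul_one]
    have := norm_le_add_norm_add (((r + ‖z‖ : ℝ) : ℂ) • u) z
    rw [mem_compl_iff, mem_ball_zero_iff, not_lt, add_comm z]
    linarith
  refine ⟨(range fun c : ℂ => z + c • u) ∪ (ball 0 r)ᶜ,
    union_subset (range_subset_iff.2 hKu) (compl_subset_compl.2 hKr),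
    Or.inr (by simpa using hp.le), Or.inl ⟨0, by simp⟩, ?_⟩
  exact hline.union' ⟨_, ⟨_, rfl⟩, hfar⟩ (isPreconnected_compl_ball hE hr)

theorem LinesEscape.isConnected_diff (hE : 1 < Module.rank ℝ E) (hG : IsOpen G)
    (hGc : IsConnected G) (hK : IsCompact K) (hKG : K ⊆ G) (hL : LinesEscape K) :
    IsConnected (G \ K) := by
  constructor
  · rw [nonempty_iff_ne_empty, Ne, sdiff_eq_empty]
    intro hGK
    obtain rfl := hKG.antisymm hGK
    have : Nontrivial E := rank_pos_iff_nontrivial.1 (zero_lt_one.trans hE)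
    have := NormedSpace.noncompactSpace ℝ E
    rcases isClopen_iff.1 ⟨hK.isClosed, hG⟩ with hempty | huniv
    · exact hGc.nonempty.ne_empty hempty
    · exact noncompact_univ E (huniv ▸ hK)
  · exact isPreconnected_inter_of_union_eq_univ hG hK.isClosed.isOpen_compl hGc.isPreconnected
      (hL.isPreconnected_compl hE hK.isBounded)
      (compl_subset_iff_union.1 (compl_subset_compl.2 hKG))

end LinesEscape

section Collapse

variable {X : Type*} {d : PseudoMetric X ℝ≥0∞} {U : Set X}

theorem ofReal_sub_le_pseudoMetric {x y z : X} {a b : ℝ} (hb0 : 0 ≤ b)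
    (ha : ENNReal.ofReal a ≤ d x y) (hb : d z y ≤ ENNReal.ofReal b) :
    ENNReal.ofReal (a - b) ≤ d x z := by
  rw [ENNReal.ofReal_sub a hb0, tsub_le_iff_right]
  exact ha.trans ((d.triangle x z y).trans (add_le_add_right hb _))

theorem iInf_le_add_iInf (d : PseudoMetric X ℝ≥0∞) (U : Set X) (x y : X) :
    ⨅ u ∈ U, d x u ≤ d x y + ⨅ u ∈ U, d y u := by
  simp only [ENNReal.add_iInf]
  exact iInf₂_mono fun u _ => d.triangle x y u

/-- The pseudodistance obtained from `d` by collapsing `U` to a point: a path may jump for free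
from any point of `U` to any other. -/
noncomputable def collapse (d : PseudoMetric X ℝ≥0∞) (U : Set X) : PseudoMetric X ℝ≥0∞ where
  toFun x y := min (d x y) ((⨅ u ∈ U, d x u) + ⨅ u ∈ U, d y u)
  refl' x := by simp
  symm' x y := by rw [d.symm, add_comm]
  triangle' x y z := by
    have hxy := iInf_le_add_iInf d U x y
    have hzy := iInf_le_add_iInf d U z y
    rw [d.symm z y] at hzy
    rw [min_add, add_min, add_min]
    refine le_min (le_min (min_le_of_left_le (d.triangle x y z)) (min_le_of_right_le ?_))
      (le_min (min_le_of_right_le ?_) (min_le_of_right_le ?_))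
    · exact (add_le_add_left hxy _).trans_eq (add_assoc _ _ _)
    · exact (add_le_add_right hzy _).trans_eq (by ring)
    · exact add_le_add le_self_add le_add_self

theorem collapse_le (x y : X) : collapse d U x y ≤ d x y := min_le_left _ _

theorem collapse_eq_zero {u v : X} (hu : u ∈ U) (hv : v ∈ U) : collapse d U u v = 0 := by
  have hzero : ∀ w ∈ U, ⨅ u ∈ U, d w u = 0 := fun w hw =>
    le_antisymm ((iInf₂_le w hw).trans_eq (d.refl w)) bot_le
  refine le_antisymm ((min_le_right _ _).trans_eq ?_) bot_le
  rw [hzero u hu, hzero v hv, add_zero]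

theorem le_collapse_add {x y : X} {M : ℝ≥0∞}
    (hM : ∀ u ∈ U, ∀ v ∈ U, d x u ≠ ⊤ → d y v ≠ ⊤ → d u v ≤ M) :
    d x y ≤ collapse d U x y + M := by
  have hjump : ∀ u ∈ U, ∀ v ∈ U, d x y ≤ d x u + d y v + M := by
    intro u hu v hv
    by_cases hx : d x u = ⊤
    · simp [hx]
    by_cases hy : d y v = ⊤
    · simp [hy]
    calc d x y ≤ d x u + (d u v + d v y) :=
          (d.triangle x u y).trans (add_le_add_right (d.triangle u v y) _)
      _ ≤ d x u + (M + d v y) := by gcongr; exact hM u hu v hv hx hy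
      _ = d x u + d y v + M := by rw [d.symm v y]; ring
  unfold collapse
  refine (le_min le_self_add ?_).trans_eq (min_add _ _ _).symm
  simp only [ENNReal.iInf_add, ENNReal.add_iInf]
  exact le_iInf₂ fun v hv => le_iInf₂ fun u hu => hjump u hu v hv

end Collapse

section Tanh

open Real

theorem tanh_sub_mul_one_sub_tanh_mul_tanh (a b : ℝ) :
    tanh (b - a) * (1 - tanh a * tanh b) = tanh b - tanh a := by
  have hab := (cosh_pos (b - a)).ne'
  simp only [tanh_eq_sinh_div_cosh]
  field_simp
  rw [sinh_sub, cosh_sub]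
  ring

theorem tanh_sub_tanh (a b : ℝ) : tanh b - tanh a = sinh (b - a) / (cosh a * cosh b) := by
  simp only [tanh_eq_sinh_div_cosh, sinh_sub]
  field_simp

theorem tanh_strictMono : StrictMono tanh := fun a b hab => by
  rw [← sub_pos, tanh_sub_tanh]
  have := sinh_pos_iff.2 (sub_pos.2 hab)
  positivity

theorem tanh_nonneg_of_nonneg {a : ℝ} (ha : 0 ≤ a) : 0 ≤ tanh a :=
  tanh_zero.symm.trans_le (tanh_strictMono.monotone ha)

theorem tanh_pos_of_pos {a : ℝ} (ha : 0 < a) : 0 < tanh a :=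
  tanh_zero.symm.trans_lt (tanh_strictMono ha)

theorem artanh_le_artanh_add {q r : ℝ} (hq : q ∈ Ioo (-1) 1) (hr : r ∈ Ioo (-1) 1) :
    artanh q ≤ artanh r + (q - r) / ((1 - q) * (1 + r)) := by
  have hq₁ : 0 < 1 + q := by linarith [hq.1]
  have hq₂ : 0 < 1 - q := by linarith [hq.2]
  have hr₁ : 0 < 1 + r := by linarith [hr.1]
  have hr₂ : 0 < 1 - r := by linarith [hr.2]
  have hlog : log ((1 + q) / (1 - q)) - log ((1 + r) / (1 - r))
      ≤ (1 + q) / (1 - q) / ((1 + r) / (1 - r)) - 1 := by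
    rw [← log_div (by positivity) (by positivity)]
    exact log_le_sub_one_of_pos (by positivity)
  have hratio : (1 + q) / (1 - q) / ((1 + r) / (1 - r)) - 1
      = 2 * ((q - r) / ((1 - q) * (1 + r))) := by
    field_simp
    ring
  rw [artanh_eq_half_log (Ioo_subset_Icc_self hq), artanh_eq_half_log (Ioo_subset_Icc_self hr)]
  linarith

theorem tanh_le_two_mul {h : ℝ} (hh : 0 ≤ h) : tanh h ≤ 2 * h := by
  have hpos := tanh_nonneg_of_nonneg hh
  have hlog := artanh_le_artanh_add (q := 0) (by simp) ⟨neg_one_lt_tanh h, tanh_lt_one h⟩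
  rw [artanh_zero, artanh_tanh, zero_sub, sub_zero, one_mul, neg_div, ← sub_eq_add_neg,
    sub_nonneg, div_le_iff₀ (by linarith)] at hlog
  nlinarith [tanh_lt_one h]

theorem one_sub_tanh_le (s : ℝ) : 1 - tanh s ≤ 2 * exp (-2 * s) := by
  have hdiff : 1 - tanh s = exp (-s) / cosh s := by
    rw [tanh_eq_sinh_div_cosh, ← cosh_sub_sinh]
    field_simp
  have hcosh : exp s ≤ 2 * cosh s := by
    rw [cosh_eq]
    linarith [exp_pos (-s)]
  rw [hdiff, div_le_iff₀ (cosh_pos s)]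
  calc exp (-s) = exp (-2 * s) * exp s := by rw [← exp_add]; ring_nf
    _ ≤ exp (-2 * s) * (2 * cosh s) := by gcongr
    _ = 2 * exp (-2 * s) * cosh s := by ring

theorem exists_artanh_tanh_div_tanh_le {s₀ : ℝ} (hs₀ : 0 < s₀) :
    ∃ C, 0 ≤ C ∧ ∀ h s : ℝ, 0 ≤ h → h ≤ s₀ / 2 → s₀ ≤ s →
      artanh (tanh h / tanh s) ≤ h + C * h * exp (-2 * s) := by
  let q₀ : ℝ := tanh (s₀ / 2) / tanh s₀
  have hts₀ := tanh_pos_of_pos hs₀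
  have hq₀ : 0 < 1 - q₀ := sub_pos.2 ((div_lt_one hts₀).2 (tanh_strictMono (half_lt_self hs₀)))
  refine ⟨4 / (tanh s₀ * (1 - q₀)), by positivity, fun h s h0 hhs hs => ?_⟩
  have hth := tanh_nonneg_of_nonneg h0
  have hts : tanh s₀ ≤ tanh s := tanh_strictMono.monotone hs
  have hts' := hts₀.trans_le hts
  have hq : tanh h / tanh s ≤ q₀ :=
    div_le_div₀ (hth.trans (tanh_strictMono.monotone hhs)) (tanh_strictMono.monotone hhs) hts₀ hts
  have hgap : tanh h / tanh s - tanh h ≤ 2 * h * (2 * exp (-2 * s)) / tanh s₀ :=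
    calc tanh h / tanh s - tanh h = tanh h * (1 - tanh s) / tanh s := by field_simp
      _ ≤ 2 * h * (2 * exp (-2 * s)) / tanh s₀ := by
        have := one_sub_tanh_le s
        have := tanh_le_two_mul h0
        have := (tanh_lt_one s).le
        gcongr
  calc artanh (tanh h / tanh s)
      ≤ artanh (tanh h)
          + (tanh h / tanh s - tanh h) / ((1 - tanh h / tanh s) * (1 + tanh h)) :=
        artanh_le_artanh_add ⟨by linarith [div_nonneg hth hts'.le], by linarith⟩
          ⟨neg_one_lt_tanh h, tanh_lt_one h⟩
    _ ≤ h + 2 * h * (2 * exp (-2 * s)) / tanh s₀ / ((1 - q₀) * 1) := by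
        rw [artanh_tanh]
        gcongr
        exacts [by linarith, le_add_of_nonneg_right hth]
    _ = h + 4 / (tanh s₀ * (1 - q₀)) * h * exp (-2 * s) := by
        field_simp
        ring

theorem le_exp_mul_tanh_sub_tanh {t h : ℝ} (h0 : 0 ≤ h) (h1 : h ≤ 1) :
    h ≤ exp (2 * |t| + 1) * (tanh (t + h) - tanh t) := by
  have hcosh : ∀ x : ℝ, cosh x ≤ exp |x| := fun x => by
    rw [← cosh_abs, cosh_eq]
    linarith [exp_le_exp.2 (neg_le_self (abs_nonneg x))]
  have hth : |t + h| ≤ |t| + 1 :=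
    (abs_add_le t h).trans (add_le_add_right ((abs_of_nonneg h0).trans_le h1) _)
  have hprod : cosh t * cosh (t + h) ≤ exp (2 * |t| + 1) :=
    calc cosh t * cosh (t + h) ≤ exp |t| * exp (|t| + 1) := by
          gcongr
          exacts [hcosh t, (hcosh _).trans (exp_le_exp.2 hth)]
      _ = exp (2 * |t| + 1) := by rw [← exp_add]; ring_nf
  rw [tanh_sub_tanh, add_sub_cancel_left, mul_div_assoc', le_div_iff₀ (by positivity), mul_comm h]
  have := self_le_sinh_iff.2 h0
  gcongr

theorem exists_artanh_tanh_div_tanh_le_add_tanh_sub {s₀ : ℝ} (hs₀ : 0 < s₀) (R : ℝ) :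
    ∃ C, 0 ≤ C ∧ ∀ h s t : ℝ, 0 ≤ h → h ≤ s₀ / 2 → h ≤ 1 → s₀ ≤ s → |t| - R ≤ s →
      artanh (tanh h / tanh s) ≤ h + C * (tanh (t + h) - tanh t) := by
  obtain ⟨C, hC, hartanh⟩ := exists_artanh_tanh_div_tanh_le hs₀
  refine ⟨C * exp (2 * R + 1), by positivity, fun h s t h0 hhs h1 hs ht => ?_⟩
  have hinc := sub_nonneg.2 (tanh_strictMono.monotone (le_add_of_nonneg_right h0 : t ≤ t + h))
  refine (hartanh h s h0 hhs hs).trans (add_le_add_right ?_ h)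
  calc C * h * exp (-2 * s)
      ≤ C * (exp (2 * |t| + 1) * (tanh (t + h) - tanh t)) * exp (-2 * s) := by
        gcongr
        exact le_exp_mul_tanh_sub_tanh h0 h1
    _ = C * exp (2 * |t| + 1 - 2 * s) * (tanh (t + h) - tanh t) := by
        rw [sub_eq_add_neg _ (2 * s), exp_add _ (-(2 * s)), neg_mul]
        ring
    _ ≤ C * exp (2 * R + 1) * (tanh (t + h) - tanh t) := by
        gcongr
        linarith

end Tanh

section DiscDist

open Real

variable {E : Type*} [NormedAddCommGroup E] [NormedSpace ℂ E] {D D' : Set E} {φ : ℂ → E}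
  {x y z : E} {δ δ' c c' h : ℝ}

/-- A holomorphic map from the unit disc to `D`. -/
structure IsHolomorphicDisc (D : Set E) (φ : ℂ → E) : Prop where
  differentiableOn : DifferentiableOn ℂ φ (ball 0 1)
  mapsTo : MapsTo φ (ball 0 1) D

theorem IsHolomorphicDisc.comp (hφ : IsHolomorphicDisc D φ) {m : ℂ → ℂ}
    (hd : DifferentiableOn ℂ m (ball 0 1)) (hm : MapsTo m (ball 0 1) (ball 0 1)) :
    IsHolomorphicDisc D (φ ∘ m) :=
  ⟨hφ.differentiableOn.comp hd hm, hφ.mapsTo.comp hm⟩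

/-- Some holomorphic disc in `D` maps two points at Poincaré distance `h` to `x` and `y`; by
homogeneity of the disc the two points can be taken to be `0` and `tanh h`. -/
def DiscStep (D : Set E) (x y : E) (h : ℝ) : Prop :=
  0 ≤ h ∧ ∃ φ, IsHolomorphicDisc D φ ∧ φ 0 = x ∧ φ (tanh h : ℝ) = y

theorem norm_ofReal_tanh (hh : 0 ≤ h) : ‖((tanh h : ℝ) : ℂ)‖ = tanh h :=
  Complex.norm_of_nonneg (tanh_nonneg_of_nonneg hh)

theorem ofReal_tanh_mem_ball (h : ℝ) : ((tanh h : ℝ) : ℂ) ∈ ball (0 : ℂ) 1 := by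
  rw [mem_ball_zero_iff, Complex.norm_real]
  exact abs_tanh_lt_one h

theorem IsHolomorphicDisc.discStep (hφ : IsHolomorphicDisc D φ) {α : ℂ} (hα : α ∈ ball (0 : ℂ) 1) :
    DiscStep D (φ 0) (φ α) (artanh ‖α‖) := by
  have hα1 := mem_ball_zero_iff.1 hα
  have hrot : MapsTo (fun l : ℂ => l * (α / ‖α‖)) (ball 0 1) (ball 0 1) := fun l hl => by
    rw [mem_ball_zero_iff] at hl ⊢
    calc ‖l * (α / ‖α‖)‖ = ‖l‖ * (‖α‖ / ‖α‖) := by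
          rw [norm_mul, norm_div, Complex.norm_real, norm_norm]
      _ ≤ ‖l‖ * 1 := by gcongr; exact div_self_le_one _
      _ < 1 := by simpa using hl
  refine ⟨artanh_nonneg (norm_nonneg α), _, hφ.comp (by fun_prop) hrot, by simp, ?_⟩
  rw [tanh_artanh ⟨by linarith [norm_nonneg α], hα1⟩, Function.comp_apply,
    mul_div_cancel_of_imp' fun hα0 => by simpa using hα0]

theorem norm_add_lt_norm_one_add_mul {a : ℝ} (ha : |a| < 1) {l : ℂ} (hl : ‖l‖ < 1) :
    ‖l + a‖ < ‖1 + a * l‖ := by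
  have ha2 : a ^ 2 < 1 := (sq_lt_one_iff_abs_lt_one a).2 ha
  have hl2 : ‖l‖ ^ 2 < 1 := (sq_lt_one_iff₀ (norm_nonneg l)).2 hl
  have hdiff : ‖1 + a * l‖ ^ 2 - ‖l + a‖ ^ 2 = (1 - a ^ 2) * (1 - ‖l‖ ^ 2) := by
    simp only [Complex.sq_norm, Complex.normSq_apply, Complex.add_re, Complex.add_im,
      Complex.ofReal_re, Complex.ofReal_im, Complex.one_re, Complex.one_im, Complex.mul_re,
      Complex.mul_im]
    ring
  rw [← sq_lt_sq₀ (norm_nonneg _) (norm_nonneg _), ← sub_pos, hdiff]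
  exact mul_pos (sub_pos.2 ha2) (sub_pos.2 hl2)

theorem IsHolomorphicDisc.discStep_tanh (hφ : IsHolomorphicDisc D φ) {a b : ℝ} (hab : a ≤ b) :
    DiscStep D (φ (tanh a : ℝ)) (φ (tanh b : ℝ)) (b - a) := by
  have hlt : ∀ l ∈ ball (0 : ℂ) 1, ‖l + (tanh a : ℝ)‖ < ‖1 + (tanh a : ℝ) * l‖ := fun l hl =>
    norm_add_lt_norm_one_add_mul (abs_tanh_lt_one a) (mem_ball_zero_iff.1 hl)
  have hpos : ∀ l ∈ ball (0 : ℂ) 1, 0 < ‖1 + (tanh a : ℝ) * l‖ := fun l hl =>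
    (norm_nonneg _).trans_lt (hlt l hl)
  have hdiff : DifferentiableOn ℂ (fun l : ℂ => (l + (tanh a : ℝ)) / (1 + (tanh a : ℝ) * l))
      (ball 0 1) :=
    .div (by fun_prop) (by fun_prop) fun l hl => norm_pos_iff.1 (hpos l hl)
  have hmaps : MapsTo (fun l : ℂ => (l + (tanh a : ℝ)) / (1 + (tanh a : ℝ) * l))
      (ball 0 1) (ball 0 1) := fun l hl => by
    rw [mem_ball_zero_iff, norm_div, div_lt_one (hpos l hl)]
    exact hlt l hl
  refine ⟨sub_nonneg.2 hab, _, hφ.comp hdiff hmaps, by simp, ?_⟩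
  rw [Function.comp_apply]
  congr 1
  rw [div_eq_iff (norm_pos_iff.1 (hpos _ (ofReal_tanh_mem_ball _)))]
  have haddition : tanh (b - a) + tanh a = tanh b * (1 + tanh a * tanh (b - a)) := by
    linarith [tanh_sub_mul_one_sub_tanh_mul_tanh a b]
  exact_mod_cast haddition

theorem DiscStep.symm (hs : DiscStep D x y h) : DiscStep D y x h := by
  obtain ⟨h0, φ, hφ, rfl, rfl⟩ := hs
  have hneg : IsHolomorphicDisc D (φ ∘ Neg.neg) :=
    hφ.comp (by fun_prop) fun l hl => by simpa using hl
  simpa using hneg.discStep_tanh (neg_nonpos.2 h0)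

theorem DiscStep.right_mem (hs : DiscStep D x y h) : y ∈ D := by
  obtain ⟨-, φ, hφ, -, rfl⟩ := hs
  exact hφ.mapsTo (ofReal_tanh_mem_ball h)

theorem DiscStep.mono (hD : D ⊆ D') (hs : DiscStep D x y h) : DiscStep D' x y h := by
  obtain ⟨h0, φ, hφ, hx, hy⟩ := hs
  exact ⟨h0, φ, ⟨hφ.differentiableOn, hφ.mapsTo.mono_right hD⟩, hx, hy⟩

/-- A chain of holomorphic discs in `D` from `x` to `y` with steps of length at most `δ` and total
length `c`. The trivial chain is not required to lie in `D`. -/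
inductive DiscChain (D : Set E) (δ : ℝ) (x : E) : E → ℝ → Prop
  | refl : DiscChain D δ x x 0
  | snoc {y z : E} {c h : ℝ} :
      DiscChain D δ x y c → DiscStep D y z h → h ≤ δ → DiscChain D δ x z (c + h)

namespace DiscChain

theorem nonneg (hc : DiscChain D δ x y c) : 0 ≤ c := by
  induction hc with
  | refl => exact le_rfl
  | snoc _ hs _ ih => exact add_nonneg ih hs.1

theorem right_mem (hx : x ∈ D) (hc : DiscChain D δ x y c) : y ∈ D := by
  cases hc with
  | refl => exact hx
  | snoc _ hs _ => exact hs.right_mem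

theorem trans (hc : DiscChain D δ x y c) (hc' : DiscChain D δ y z c') :
    DiscChain D δ x z (c + c') := by
  induction hc' with
  | refl => simpa using hc
  | snoc _ hs hδ ih => simpa only [add_assoc] using ih.snoc hs hδ

theorem symm (hc : DiscChain D δ x y c) : DiscChain D δ y x c := by
  induction hc with
  | refl => exact refl
  | @snoc y z c h _ hs hδ ih =>
    simpa only [zero_add, add_comm h] using (refl.snoc hs.symm hδ).trans ih

theorem of_discStep (hs : DiscStep D x y h) (hδ : 0 < δ) : DiscChain D δ x y h := by
  obtain ⟨h0, φ, hφ, rfl, rfl⟩ := hs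
  obtain ⟨N, hN⟩ := exists_nat_gt (h / δ)
  have hN0 : (0 : ℝ) < N := (div_nonneg h0 hδ.le).trans_lt hN
  have hmesh : h / N ≤ δ := (div_le_comm₀ hN0 hδ).2 hN.le
  have hsteps : ∀ j : ℕ, DiscChain D δ (φ 0) (φ (tanh (j * (h / N)) : ℝ)) (j * (h / N)) := by
    intro j
    induction j with
    | zero => simpa using refl
    | succ j ih =>
      have hlen : (j + 1 : ℕ) * (h / N) - j * (h / N) = h / N := by
        push_cast
        ring
      have hstep := hφ.discStep_tanh (a := j * (h / N)) (b := (j + 1 : ℕ) * (h / N)) <| by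
        rw [← sub_nonneg, hlen]
        positivity
      simpa using ih.snoc hstep (hlen.trans_le hmesh)
  simpa only [mul_div_cancel₀ h hN0.ne'] using hsteps N

theorem refine (hD : D ⊆ D') (hδ : 0 < δ') (hc : DiscChain D δ x y c) : DiscChain D' δ' x y c := by
  induction hc with
  | refl => exact refl
  | snoc _ hs _ ih => exact ih.trans (of_discStep (hs.mono hD) hδ)

end DiscChain

/-- The infimum of the lengths of the chains of holomorphic discs in `D` from `x` to `y`. It is
defined on the whole ambient space and infinite where there is no chain. The bound `1` on the steps
is immaterial, as steps can be subdivided. -/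
noncomputable def discDist (D : Set E) : PseudoMetric E ℝ≥0∞ where
  toFun x y := ⨅ (c : ℝ) (_ : DiscChain D 1 x y c), ENNReal.ofReal c
  refl' _ := le_antisymm ((iInf₂_le 0 .refl).trans_eq ENNReal.ofReal_zero) bot_le
  symm' x y := iInf_congr fun _ => iInf_congr_Prop ⟨.symm, .symm⟩ fun _ => rfl
  triangle' x y z := by
    simp only [ENNReal.iInf_add, ENNReal.add_iInf]
    exact le_iInf₂ fun c hc => le_iInf₂ fun c' hc' =>
      (iInf₂_le _ (hc'.trans hc)).trans_eq (ENNReal.ofReal_add hc'.nonneg hc.nonneg)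

theorem DiscChain.discDist_le (hc : DiscChain D δ x y c) :
    discDist D x y ≤ ENNReal.ofReal c :=
  iInf₂_le c (hc.refine subset_rfl one_pos)

theorem DiscStep.discDist_le (hs : DiscStep D x y h) : discDist D x y ≤ ENNReal.ofReal h :=
  (DiscChain.of_discStep hs one_pos).discDist_le

theorem exists_discChain_of_discDist_lt (hδ : 0 < δ) {a : ℝ≥0∞} (h : discDist D x y < a) :
    ∃ c, DiscChain D δ x y c ∧ ENNReal.ofReal c < a := by
  obtain ⟨c, hc⟩ := iInf_lt_iff.1 h
  obtain ⟨hc, hca⟩ := iInf_lt_iff.1 hc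
  exact ⟨c, hc.refine subset_rfl hδ, hca⟩

theorem le_discDist {d : PseudoMetric E ℝ≥0∞}
    (hd : ∀ x y h, DiscStep D x y h → d x y ≤ ENNReal.ofReal h) : d x y ≤ discDist D x y := by
  refine le_iInf₂ fun c hc => ?_
  induction hc with
  | refl => simp
  | snoc hc hs _ ih =>
    exact (d.triangle _ _ _).trans <| (add_le_add ih (hd _ _ _ hs)).trans_eq
      (ENNReal.ofReal_add hc.nonneg hs.1).symm

theorem discDist_anti (hD : D ⊆ D') : discDist D' x y ≤ discDist D x y :=
  le_discDist fun _ _ _ hs => (hs.mono hD).discDist_le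

theorem mem_of_discDist_ne_top (hx : x ∈ D) (h : discDist D x y ≠ ⊤) : y ∈ D := by
  obtain ⟨c, hc, -⟩ := exists_discChain_of_discDist_lt one_pos h.lt_top
  exact hc.right_mem hx

theorem DiscStep.dist_le {R : ℝ} (hR : ∀ x ∈ D, ∀ y ∈ D, dist x y ≤ R) (hs : DiscStep D x y h) :
    dist x y ≤ 2 * R * h := by
  obtain ⟨h0, φ, hφ, rfl, rfl⟩ := hs
  have hφ0 : φ 0 ∈ D := hφ.mapsTo (mem_ball_self one_pos)
  have hR0 : 0 ≤ R := dist_nonneg.trans (hR _ hφ0 _ hφ0)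
  calc dist (φ 0) (φ (tanh h : ℝ)) = dist (φ (tanh h : ℝ)) (φ 0) := dist_comm _ _
    _ ≤ R / 1 * dist ((tanh h : ℝ) : ℂ) 0 :=
      Complex.dist_le_div_mul_dist_of_mapsTo_ball hφ.differentiableOn
        (fun l hl => hR _ (hφ.mapsTo hl) _ hφ0) (ofReal_tanh_mem_ball h)
    _ = R * tanh h := by rw [div_one, dist_zero_right, norm_ofReal_tanh h0]
    _ ≤ R * (2 * h) := by gcongr; exact tanh_le_two_mul h0
    _ = 2 * R * h := by ring

theorem ofReal_dist_div_le_discDist {R : ℝ} (hR0 : 0 < R)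
    (hR : ∀ x ∈ D, ∀ y ∈ D, dist x y ≤ R) :
    ENNReal.ofReal (dist x y / (2 * R)) ≤ discDist D x y := by
  refine le_iInf₂ fun c hc => ENNReal.ofReal_le_ofReal ((div_le_iff₀' (by positivity)).2 ?_)
  induction hc with
  | refl => simp
  | @snoc y z _ _ _ hs _ ih => linarith [dist_triangle x y z, hs.dist_le hR]

theorem eq_of_discDist_eq_zero (hD : Bornology.IsBounded D) (h : discDist D x y = 0) : x = y := by
  obtain ⟨R, hR⟩ := isBounded_iff.1 hD
  have hR1 : 0 < max R 1 := lt_max_of_lt_right one_pos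
  have hle := ofReal_dist_div_le_discDist (x := x) (y := y) hR1
    fun _ hu _ hv => le_max_of_le_left (hR hu hv)
  rw [h, nonpos_iff_eq_zero, ENNReal.ofReal_eq_zero, div_le_iff₀ (by positivity), zero_mul] at hle
  exact dist_le_zero.1 hle

theorem discDist_add_le {v : E} (hv : ∀ l ∈ ball (0 : ℂ) 2, x + l • v ∈ D) :
    discDist D x (x + v) ≤ ENNReal.ofReal (artanh 2⁻¹) := by
  have hφ : IsHolomorphicDisc D fun l : ℂ => x + (2 * l) • v :=
    ⟨by fun_prop, fun l hl => hv _ (by simpa using hl)⟩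
  have hstep := hφ.discStep (α := 2⁻¹) (by norm_num)
  simpa using hstep.discDist_le

theorem exists_closedBall_discDist_le (hD : IsOpen D) (hx : x ∈ D) :
    ∃ r > 0, ∀ y ∈ closedBall x r, discDist D x y ≤ ENNReal.ofReal (artanh 2⁻¹) := by
  obtain ⟨r, hr, hrD⟩ := Metric.isOpen_iff.1 hD x hx
  refine ⟨r / 2, half_pos hr, fun y hy => ?_⟩
  rw [mem_closedBall_iff_norm] at hy
  have hball : ∀ l ∈ ball (0 : ℂ) 2, x + l • (y - x) ∈ D := fun l hl => hrD <| by
    rw [mem_ball_zero_iff] at hl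
    rw [mem_ball_iff_norm, add_sub_cancel_left, norm_smul]
    nlinarith [norm_nonneg l]
  simpa using discDist_add_le hball

theorem discDist_ne_top (hD : IsOpen D) (hDc : IsPreconnected D) (hx : x ∈ D) (hy : y ∈ D) :
    discDist D x y ≠ ⊤ := by
  refine hDc.induction₂ (fun x y => discDist D x y ≠ ⊤) (fun x hx => ?_)
    (fun x y z _ _ _ hxy hyz => ?_) (fun x y _ _ hxy => ?_) hx hy
  · obtain ⟨r, hr, hball⟩ := exists_closedBall_discDist_le hD hx
    filter_upwards [mem_nhdsWithin_of_mem_nhds (closedBall_mem_nhds x hr)] with y hy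
    exact ne_top_of_le_ne_top ENNReal.ofReal_ne_top (hball y hy)
  · exact ne_top_of_le_ne_top (ENNReal.add_ne_top.2 ⟨hxy, hyz⟩) ((discDist D).triangle x y z)
  · rwa [(discDist D).symm]

theorem exists_discDist_le_of_isCompact {S : Set E} (hD : IsOpen D) (hDc : IsPreconnected D)
    (hx : x ∈ D) (hS : IsCompact S) (hSD : S ⊆ D) :
    ∃ M : ℝ≥0∞, M ≠ ⊤ ∧ ∀ y ∈ S, discDist D x y ≤ M := by
  refine hS.induction_on (p := fun S => ∃ M : ℝ≥0∞, M ≠ ⊤ ∧ ∀ y ∈ S, discDist D x y ≤ M)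
    ⟨0, by simp⟩ ?_ ?_ fun y hy => ?_
  · rintro s t hst ⟨M, hM, hMt⟩
    exact ⟨M, hM, fun y hy => hMt y (hst hy)⟩
  · rintro s t ⟨M, hM, hMs⟩ ⟨N, hN, hNt⟩
    refine ⟨max M N, max_ne_top hM hN, ?_⟩
    rintro y (hy | hy)
    exacts [le_max_of_le_left (hMs y hy), le_max_of_le_right (hNt y hy)]
  · obtain ⟨r, hr, hball⟩ := exists_closedBall_discDist_le hD (hSD hy)
    exact ⟨closedBall y r, mem_nhdsWithin_of_mem_nhds (closedBall_mem_nhds y hr), _,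
      ENNReal.add_ne_top.2 ⟨discDist_ne_top hD hDc hx (hSD hy), ENNReal.ofReal_ne_top⟩,
      fun w hw => ((discDist D).triangle x y w).trans (add_le_add_right (hball w hw) _)⟩

theorem DiscStep.diff {G K : Set E} {s : ℝ} (hs : DiscStep G x y h) (hhs : h < s)
    (hK : ∀ p ∈ K, ENNReal.ofReal s ≤ discDist G x p) :
    DiscStep (G \ K) x y (artanh (tanh h / tanh s)) := by
  obtain ⟨h0, φ, hφ, rfl, rfl⟩ := hs
  have hts : 0 < tanh s := tanh_pos_of_pos (h0.trans_lt hhs)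
  have hshrink : ∀ l ∈ ball (0 : ℂ) 1, ‖(tanh s : ℝ) * l‖ < tanh s := fun l hl => by
    rw [norm_mul, norm_ofReal_tanh (h0.trans hhs.le)]
    exact mul_lt_of_lt_one_right hts (mem_ball_zero_iff.1 hl)
  have hunit : MapsTo (fun l : ℂ => (tanh s : ℝ) * l) (ball 0 1) (ball 0 1) := fun l hl =>
    mem_ball_zero_iff.2 ((hshrink l hl).trans (tanh_lt_one s))
  have hφ' : IsHolomorphicDisc (G \ K) (φ ∘ fun l => (tanh s : ℝ) * l) := by
    have hcomp := hφ.comp (m := fun l => (tanh s : ℝ) * l) (by fun_prop) hunit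
    refine ⟨hcomp.differentiableOn, fun l hl => ⟨hcomp.mapsTo hl, fun hlK => ?_⟩⟩
    have hle := (hK _ hlK).trans (hφ.discStep (hunit hl)).discDist_le
    rw [ENNReal.ofReal_le_ofReal_iff (artanh_nonneg (norm_nonneg _))] at hle
    have hlt := artanh_lt_artanh (by linarith [norm_nonneg ((tanh s : ℝ) * l)]) (tanh_lt_one s)
      (hshrink l hl)
    rw [artanh_tanh] at hlt
    exact hlt.not_ge hle
  have hratio : ‖((tanh h / tanh s : ℝ) : ℂ)‖ = tanh h / tanh s :=
    Complex.norm_of_nonneg (div_nonneg (tanh_nonneg_of_nonneg h0) hts.le)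
  have hstep := hφ'.discStep (α := (tanh h / tanh s : ℝ)) <| by
    rw [mem_ball_zero_iff, hratio, div_lt_one hts]
    exact tanh_strictMono hhs
  rwa [hratio, Function.comp_apply, Function.comp_apply, mul_zero, ← Complex.ofReal_mul,
    mul_div_cancel₀ _ hts.ne'] at hstep

end DiscDist

section NearK

open Real

variable {E : Type*} [NormedAddCommGroup E] [NormedSpace ℂ E] {D G K S : Set E} {x v : E}

theorem discDist_add_nat_smul_le {n : ℕ}
    (hv : ∀ i < n, ∀ l ∈ ball (0 : ℂ) 2, x + (i : ℂ) • v + l • v ∈ D) :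
    discDist D x (x + (n : ℂ) • v) ≤ n * ENNReal.ofReal (artanh 2⁻¹) := by
  induction n with
  | zero => simp
  | succ n ih =>
    have hstep := discDist_add_le (hv n n.lt_succ_self)
    calc discDist D x (x + ((n + 1 : ℕ) : ℂ) • v)
        = discDist D x (x + (n : ℂ) • v + v) := by rw [Nat.cast_succ, add_smul, one_smul, add_assoc]
      _ ≤ n * ENNReal.ofReal (artanh 2⁻¹) + ENNReal.ofReal (artanh 2⁻¹) :=
        ((discDist D).triangle _ _ _).trans
          (add_le_add (ih fun i hi => hv i (hi.trans n.lt_succ_self)) hstep)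
      _ = (n + 1 : ℕ) * ENNReal.ofReal (artanh 2⁻¹) := by rw [Nat.cast_succ, add_one_mul]

theorem exists_last_nat_add_smul_mem (hS : Bornology.IsBounded S) {ρ : ℝ} (hρ : 0 < ρ) :
    ∃ N : ℕ, ∀ x ∈ S, ∀ v : E, ρ ≤ ‖v‖ → ∃ n < N,
      (∀ i ≤ n, x + (i : ℂ) • v ∈ S) ∧ x + ((n + 1 : ℕ) : ℂ) • v ∉ S := by
  classical
  obtain ⟨B, hB⟩ := isBounded_iff.1 hS
  obtain ⟨N, hN⟩ := exists_nat_gt (B / ρ)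
  rw [div_lt_iff₀ hρ] at hN
  refine ⟨N, fun x hx v hv => ?_⟩
  have hout : x + (N : ℂ) • v ∉ S := fun hmem => by
    have hdist := hB hmem hx
    rw [dist_eq_norm, add_sub_cancel_left, norm_smul, Complex.norm_natCast] at hdist
    have := mul_le_mul_of_nonneg_left hv N.cast_nonneg
    linarith
  have hex : ∃ n : ℕ, x + (n : ℂ) • v ∉ S := ⟨N, hout⟩
  have hspec := Nat.find_spec hex
  obtain ⟨n, hn⟩ := Nat.exists_eq_add_one_of_ne_zero (n := Nat.find hex) fun h0 =>
    hspec (by simpa [h0] using hx)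
  rw [hn] at hspec
  refine ⟨n, hn.symm.trans_le (Nat.find_min' hex hout), fun i hi => ?_, hspec⟩
  exact not_not.1 (Nat.find_min hex (hn ▸ Nat.lt_succ_of_le hi))

theorem LinesEscape.exists_exit_discDist_diff_le (hL : LinesEscape K)
    (hK : Bornology.IsBounded K) {r : ℝ} (hr : 0 < r) (hKG : cthickening (2 * r) K ⊆ G) :
    ∃ M : ℝ≥0∞, M ≠ ⊤ ∧ ∀ x ∈ thickening r K \ K,
      ∃ p ∈ cthickening (2 * r) K \ thickening r K, discDist (G \ K) x p ≤ M := by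
  obtain ⟨N, hN⟩ := exists_last_nat_add_smul_mem (hK.thickening (δ := r)) (half_pos hr)
  refine ⟨N * ENNReal.ofReal (artanh 2⁻¹),
    ENNReal.mul_ne_top (ENNReal.natCast_ne_top N) ENNReal.ofReal_ne_top, fun x hx => ?_⟩
  obtain ⟨u, hu, hKu⟩ := hL x hx.2
  let v : E := ((r / 2 : ℝ) : ℂ) • u
  have hv : ‖v‖ = r / 2 := by
    rw [norm_smul, hu, Complex.norm_of_nonneg (by positivity), mul_one]
  obtain ⟨n, hnN, hin, hout⟩ := hN x hx.1 v hv.ge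
  have hnear : ∀ i ≤ n, ∀ l ∈ ball (0 : ℂ) 2,
      x + (i : ℂ) • v + l • v ∈ cthickening (2 * r) K := fun i hi l hl => by
    have hdist : dist (x + (i : ℂ) • v + l • v) (x + (i : ℂ) • v) < r := by
      rw [dist_eq_norm, add_sub_cancel_left, norm_smul, hv]
      linarith [mul_lt_mul_of_pos_right (mem_ball_zero_iff.1 hl) (half_pos hr)]
    rw [two_mul]
    exact thickening_subset_cthickening _ _ (thickening_thickening_subset _ _ _
      (mem_thickening_iff.2 ⟨_, hin i hi, hdist⟩))
  have hline : ∀ i l : ℂ, x + i • v + l • v ∉ K := fun i l => by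
    simpa only [v, smul_smul, add_assoc, ← add_smul] using hKu _
  refine ⟨x + ((n + 1 : ℕ) : ℂ) • v, ⟨?_, hout⟩, ?_⟩
  · simpa only [Nat.cast_succ, add_smul, add_assoc] using hnear n le_rfl 1 (by simp)
  · refine (discDist_add_nat_smul_le (D := G \ K) fun i hi l hl =>
      ⟨hKG (hnear i (Nat.le_of_lt_succ hi) l hl), hline i l⟩).trans ?_
    gcongr
    exact hnN

theorem LinesEscape.exists_discDist_diff_le_of_mem_thickening [ProperSpace E] (hL : LinesEscape K)
    (hG : IsOpen G) (hK : IsCompact K) (hKG : K ⊆ G) (hGK : IsConnected (G \ K)) :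
    ∃ r > 0, ∃ M : ℝ≥0∞, M ≠ ⊤ ∧
      ∀ x ∈ thickening r K \ K, ∀ y ∈ thickening r K \ K, discDist (G \ K) x y ≤ M := by
  obtain ⟨ρ, hρ, hρG⟩ := hK.exists_cthickening_subset_open hG hKG
  obtain ⟨r, rfl⟩ : ∃ r, ρ = 2 * r := ⟨ρ / 2, by ring⟩
  have hr : 0 < r := by linarith
  obtain ⟨o, ho⟩ := hGK.nonempty
  obtain ⟨M, hM, hexit⟩ := hL.exists_exit_discDist_diff_le hK.isBounded hr hρG
  obtain ⟨M', hM', hshell⟩ := exists_discDist_le_of_isCompact (hG.sdiff hK.isClosed)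
    hGK.isPreconnected ho (hK.cthickening.diff isOpen_thickening)
    (sdiff_subset_sdiff hρG (self_subset_thickening hr K))
  have hcentre : ∀ x ∈ thickening r K \ K, discDist (G \ K) o x ≤ M' + M := fun x hx => by
    obtain ⟨p, hp, hxp⟩ := hexit x hx
    refine ((discDist (G \ K)).triangle o p x).trans (add_le_add (hshell p hp) ?_)
    rwa [(discDist (G \ K)).symm]
  refine ⟨r, hr, (M' + M) + (M' + M), by finiteness, fun x hx y hy => ?_⟩
  refine ((discDist (G \ K)).triangle x o y).trans (add_le_add ?_ (hcentre y hy))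
  rw [(discDist (G \ K)).symm]
  exact hcentre x hx

end NearK

section Comparison

open Real

variable {E : Type*} [NormedAddCommGroup E] [NormedSpace ℂ E] {D G K : Set E} {o z w : E}

theorem exists_discDist_diff_le_of_discStep (hG : IsOpen G) (hGc : IsPreconnected G)
    (hb : Bornology.IsBounded G) (hK : IsCompact K) (hKG : K ⊆ G) (ho : o ∈ G) {r : ℝ}
    (hr : 0 < r) : ∃ C, 0 ≤ C ∧ ∃ δ > 0, ∀ y y' : E, ∀ h t : ℝ, y ∉ thickening r K →
      DiscStep G y y' h → h ≤ δ → ENNReal.ofReal (|t| - 1) ≤ discDist G o y →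
      discDist (G \ K) y y' ≤ ENNReal.ofReal (h + C * (tanh (t + h) - tanh t)) := by
  obtain ⟨R, hR⟩ := isBounded_iff.1 hb
  have hR1 : 0 < max R 1 := lt_max_of_lt_right one_pos
  let s₀ : ℝ := r / (2 * max R 1)
  have hs₀ : 0 < s₀ := by positivity
  obtain ⟨M, hM, hoK⟩ := exists_discDist_le_of_isCompact hG hGc ho hK hKG
  obtain ⟨C, hC, hartanh⟩ := exists_artanh_tanh_div_tanh_le_add_tanh_sub hs₀ (1 + M.toReal)
  refine ⟨C, hC, min (s₀ / 2) 1, by positivity, fun y y' h t hyU hs hh ht => ?_⟩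
  let s : ℝ := max s₀ (|t| - (1 + M.toReal))
  have hhs : h ≤ s₀ / 2 := hh.trans (min_le_left _ _)
  have hnear : ∀ p ∈ K, ENNReal.ofReal s₀ ≤ discDist G y p := fun p hp => by
    have hdist : r ≤ dist y p := by
      by_contra! hlt
      exact hyU (mem_thickening_iff.2 ⟨p, hp, hlt⟩)
    refine le_trans (ENNReal.ofReal_le_ofReal ?_) (ofReal_dist_div_le_discDist hR1
      fun u hu v hv => le_max_of_le_left (hR hu hv))
    simp only [s₀]
    gcongr
  have hfar : ∀ p ∈ K, ENNReal.ofReal (|t| - (1 + M.toReal)) ≤ discDist G y p := fun p hp => by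
    rw [(discDist G).symm] at ht
    rw [← sub_sub]
    refine ofReal_sub_le_pseudoMetric ENNReal.toReal_nonneg ht ?_
    rw [(discDist G).symm, ENNReal.ofReal_toReal hM]
    exact hoK p hp
  have hdiff := hs.diff (s := s) (lt_max_of_lt_left (by linarith)) fun p hp => by
    rcases max_choice s₀ (|t| - (1 + M.toReal)) with hmax | hmax
    exacts [(congrArg _ hmax).trans_le (hnear p hp), (congrArg _ hmax).trans_le (hfar p hp)]
  exact hdiff.discDist_le.trans (ENNReal.ofReal_le_ofReal (hartanh h s t hs.1 hhs
    (hh.trans (min_le_right _ _)) (le_max_left _ _) (le_max_right _ _)))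

theorem exists_collapse_discDist_diff_le_of_discStep (hG : IsOpen G) (hGc : IsPreconnected G)
    (hb : Bornology.IsBounded G) (hK : IsCompact K) (hKG : K ⊆ G) (ho : o ∈ G) {r : ℝ}
    (hr : 0 < r) : ∃ C, 0 ≤ C ∧ ∃ δ > 0, ∀ y y' : E, ∀ h t : ℝ, DiscStep G y y' h → h ≤ δ →
      ENNReal.ofReal (|t| - 1) ≤ discDist G o y →
      ENNReal.ofReal (|t + h| - 1) ≤ discDist G o y' →
      collapse (discDist (G \ K)) (thickening r K) y y'
        ≤ ENNReal.ofReal (h + C * (tanh (t + h) - tanh t)) := by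
  obtain ⟨C, hC, δ, hδ, hstep⟩ := exists_discDist_diff_le_of_discStep hG hGc hb hK hKG ho hr
  refine ⟨C, hC, δ, hδ, fun y y' h t hs hh ht ht' => ?_⟩
  by_cases hy : y ∈ thickening r K
  · by_cases hy' : y' ∈ thickening r K
    · simp [collapse_eq_zero hy hy']
    · have hrev := hstep y' y h (-(t + h)) hy' hs.symm hh (by rwa [abs_neg])
      rw [show -(t + h) + h = -t by ring, tanh_neg, tanh_neg, neg_sub_neg] at hrev
      rw [(collapse _ _).symm]
      exact (collapse_le _ _).trans hrev
  · exact (collapse_le _ _).trans (hstep y y' h t hy hs hh ht)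

/- A nearly minimal chain from `z` to `w` is closest to `o` about the time `(A + T - B) / 2` and
recedes from `o` at unit speed before and after. -/
theorem DiscChain.ofReal_abs_sub_le_discDist {y : E} {δ A B T b c : ℝ}
    (hA : ENNReal.ofReal A ≤ discDist D o z) (hB : ENNReal.ofReal B ≤ discDist D o w)
    (hT : T ≤ A + B + 1) (hzy : DiscChain D δ z y c) (hb : 0 ≤ b) (hcb : c + b = T)
    (hyw : discDist D y w ≤ ENNReal.ofReal b) :
    ENNReal.ofReal (|c - (A + T - B) / 2| - 1) ≤ discDist D o y := by
  rcases abs_choice (c - (A + T - B) / 2) with habs | habs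
  · exact (ENNReal.ofReal_le_ofReal (by linarith)).trans (ofReal_sub_le_pseudoMetric hb hB hyw)
  · exact (ENNReal.ofReal_le_ofReal (by linarith)).trans
      (ofReal_sub_le_pseudoMetric hzy.nonneg hA hzy.symm.discDist_le)

/- The excess of each step over its length is the increment of a bounded function of the time, so
the excesses telescope. -/
theorem DiscChain.le_ofReal_add_two_mul {d : PseudoMetric E ℝ≥0∞} {C δ A B T : ℝ} (hC : 0 ≤ C)
    (hd : ∀ y y' : E, ∀ h t : ℝ, DiscStep D y y' h → h ≤ δ →
      ENNReal.ofReal (|t| - 1) ≤ discDist D o y → ENNReal.ofReal (|t + h| - 1) ≤ discDist D o y' →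
      d y y' ≤ ENNReal.ofReal (h + C * (tanh (t + h) - tanh t)))
    (hA : ENNReal.ofReal A ≤ discDist D o z) (hB : ENNReal.ofReal B ≤ discDist D o w)
    (hT : T ≤ A + B + 1) (hzw : DiscChain D δ z w T) : d z w ≤ ENNReal.ofReal (T + 2 * C) := by
  let τ : ℝ := (A + T - B) / 2
  have hprefix : ∀ y c, DiscChain D δ z y c → ∀ b, 0 ≤ b → c + b = T →
      discDist D y w ≤ ENNReal.ofReal b →
      d z y ≤ ENNReal.ofReal (c + C * (tanh (c - τ) - tanh (-τ))) := by
    intro y c hzy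
    induction hzy with
    | refl => simp
    | @snoc y y' c h hzy hs hh ih =>
      intro b hb hcb hy'w
      have hyw : discDist D y w ≤ ENNReal.ofReal (h + b) := by
        rw [ENNReal.ofReal_add hs.1 hb]
        exact ((discDist D).triangle y y' w).trans (add_le_add hs.discDist_le hy'w)
      have hb' : 0 ≤ h + b := add_nonneg hs.1 hb
      have hcb' : c + (h + b) = T := by rw [← add_assoc, hcb]
      have hτh : c + h - τ = c - τ + h := by ring
      have hfar := hzy.ofReal_abs_sub_le_discDist hA hB hT hb' hcb' hyw
      have hfar' : ENNReal.ofReal (|c + h - τ| - 1) ≤ discDist D o y' :=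
        (hzy.snoc hs hh).ofReal_abs_sub_le_discDist hA hB hT hb hcb hy'w
      rw [hτh] at hfar' ⊢
      have hyy' := hd y y' h (c - τ) hs hh hfar hfar'
      have htanh₁ : tanh (-τ) ≤ tanh (c - τ) :=
        tanh_strictMono.monotone (by linarith [hzy.nonneg])
      have htanh₂ : tanh (c - τ) ≤ tanh (c - τ + h) := tanh_strictMono.monotone (by linarith [hs.1])
      calc d z y' ≤ d z y + d y y' := d.triangle z y y'
        _ ≤ _ := add_le_add (ih _ hb' hcb' hyw) hyy'
        _ = _ := by
          rw [← ENNReal.ofReal_add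
            (add_nonneg hzy.nonneg (mul_nonneg hC (sub_nonneg.2 htanh₁)))
            (add_nonneg hs.1 (mul_nonneg hC (sub_nonneg.2 htanh₂)))]
          ring_nf
  refine (hprefix w T hzw 0 le_rfl (add_zero T) (by simp)).trans (ENNReal.ofReal_le_ofReal ?_)
  have : tanh (T - τ) - tanh (-τ) ≤ 2 := by linarith [tanh_lt_one (T - τ), neg_one_lt_tanh (-τ)]
  linarith [mul_le_mul_of_nonneg_left this hC]

theorem LinesEscape.exists_discDist_diff_le_add [ProperSpace E] (hL : LinesEscape K)
    (hG : IsOpen G) (hGc : IsPreconnected G) (hb : Bornology.IsBounded G) (hK : IsCompact K)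
    (hKG : K ⊆ G) (hGK : IsConnected (G \ K)) :
    ∃ C : ℝ≥0∞, C ≠ ⊤ ∧
      ∀ z ∈ G \ K, ∀ w ∈ G \ K, discDist (G \ K) z w ≤ discDist G z w + C := by
  obtain ⟨o, ho, -⟩ := hGK.nonempty
  obtain ⟨r, hr, M, hM, hnear⟩ := hL.exists_discDist_diff_le_of_mem_thickening hG hK hKG hGK
  obtain ⟨C, hC, δ, hδ, hstep⟩ :=
    exists_collapse_discDist_diff_le_of_discStep hG hGc hb hK hKG ho hr
  refine ⟨1 + ENNReal.ofReal (2 * C) + M, by finiteness, fun z hz w hw => ?_⟩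
  have hoz := discDist_ne_top hG hGc ho hz.1
  have how := discDist_ne_top hG hGc ho hw.1
  have hzw := discDist_ne_top hG hGc hz.1 hw.1
  obtain ⟨T, hchain, hT⟩ := exists_discChain_of_discDist_lt hδ
    (ENNReal.lt_add_right hzw one_ne_zero)
  have hTle : T ≤ (discDist G o z).toReal + (discDist G o w).toReal + 1 := by
    rw [← ENNReal.ofReal_le_ofReal_iff (by positivity),
      ENNReal.ofReal_add (by positivity) one_pos.le,
      ENNReal.ofReal_add (by positivity) (by positivity),
      ENNReal.ofReal_toReal hoz, ENNReal.ofReal_toReal how, ENNReal.ofReal_one,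
      (discDist G).symm o z]
    exact hT.le.trans (add_le_add_left ((discDist G).triangle z o w) 1)
  have hcollapse := hchain.le_ofReal_add_two_mul hC hstep (ENNReal.ofReal_toReal hoz).le
    (ENNReal.ofReal_toReal how).le hTle
  calc discDist (G \ K) z w
      ≤ collapse (discDist (G \ K)) (thickening r K) z w + M :=
        le_collapse_add fun u hu v hv hzu hwv =>
          hnear u ⟨hu, (mem_of_discDist_ne_top hz hzu).2⟩ v ⟨hv, (mem_of_discDist_ne_top hw hwv).2⟩
    _ ≤ ENNReal.ofReal T + ENNReal.ofReal (2 * C) + M := by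
        rw [← ENNReal.ofReal_add hchain.nonneg (by positivity)]
        gcongr
    _ ≤ discDist G z w + 1 + ENNReal.ofReal (2 * C) + M := by gcongr
    _ = discDist G z w + (1 + ENNReal.ofReal (2 * C) + M) := by ring

end Comparison

section Kobayashi

variable {n : ℕ} {D D' G K : Set (Cn n)}

theorem DiscStep.lempert_le {x y : Cn n} {h : ℝ} (hs : DiscStep D x y h) :
    lempert D x y ≤ ENNReal.ofReal h := by
  obtain ⟨h0, φ, hφ, hx, hy⟩ := hs
  refine iInf₂_le_of_le _ (ofReal_tanh_mem_ball h)
    (iInf_le_of_le ⟨φ, hφ.differentiableOn, hφ.mapsTo, hx, hy⟩ ?_)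
  rw [norm_ofReal_tanh h0, Real.artanh_tanh]

theorem discDist_le_lempert (x y : Cn n) : discDist D x y ≤ lempert D x y := by
  refine le_iInf₂ fun α hα => le_iInf ?_
  rintro ⟨φ, hd, hm, rfl, rfl⟩
  exact (IsHolomorphicDisc.discStep ⟨hd, hm⟩ hα).discDist_le

theorem kobayashiE_eq_discDist (z w : D) : kobayashiE D z w = discDist D z w := by
  refine le_antisymm (iSup₂_le fun d hd => le_iInf₂ fun c hc => ?_) ?_
  · have hchain : ∀ y c, DiscChain D 1 (z : Cn n) y c → ∀ hy : y ∈ D,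
        d z ⟨y, hy⟩ ≤ ENNReal.ofReal c := by
      intro y c hc
      induction hc with
      | refl => simp
      | @snoc y y' c h hc hs _ ih =>
        intro hy'
        have hy := hc.right_mem z.2
        calc d z ⟨y', hy'⟩ ≤ d z ⟨y, hy⟩ + d ⟨y, hy⟩ ⟨y', hy'⟩ := d.triangle _ _ _
          _ ≤ ENNReal.ofReal c + ENNReal.ofReal h :=
            add_le_add (ih hy) ((hd _ _).trans hs.lempert_le)
          _ = ENNReal.ofReal (c + h) := (ENNReal.ofReal_add hc.nonneg hs.1).symm
    exact hchain w c hc w.2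
  · let d : PseudoMetric D ℝ≥0∞ :=
      { toFun x y := discDist D x y
        refl' x := (discDist D).refl x
        symm' x y := (discDist D).symm x y
        triangle' x y z := (discDist D).triangle x y z }
    exact le_iSup₂_of_le (f := fun (d : PseudoMetric D ℝ≥0∞)
      (_ : ∀ x y : D, d x y ≤ lempert D x y) => d z w) d (fun x y => discDist_le_lempert _ _) le_rfl

theorem kobayashi_eq_toReal_discDist (z w : D) : kobayashi D z w = (discDist D z w).toReal := by
  rw [kobayashi, kobayashiE_eq_discDist]

theorem IsDomainSet.discDist_ne_top (hD : IsDomainSet D) (z w : D) : discDist D z w ≠ ⊤ :=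
  _root_.discDist_ne_top hD.1 hD.2.isPreconnected z.2 w.2

theorem IsDomainSet.isDistance_kobayashi (hD : IsDomainSet D) (hb : Bornology.IsBounded D) :
    IsDistance (kobayashi D) where
  nonneg _ _ := ENNReal.toReal_nonneg
  eq_zero_iff x y := by
    rw [kobayashi_eq_toReal_discDist, ENNReal.toReal_eq_zero_iff,
      or_iff_left (hD.discDist_ne_top x y)]
    refine ⟨fun h => Subtype.ext (eq_of_discDist_eq_zero hb h), ?_⟩
    rintro rfl
    exact (discDist D).refl _
  symm x y := by
    rw [kobayashi_eq_toReal_discDist, kobayashi_eq_toReal_discDist, (discDist D).symm]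
  triangle x y z := by
    simp only [kobayashi_eq_toReal_discDist]
    exact ENNReal.toReal_le_add ((discDist D).triangle _ _ _) (hD.discDist_ne_top x y)
      (hD.discDist_ne_top y z)

theorem IsDomainSet.kobayashi_inclusion_le (hD : IsDomainSet D) (h : D ⊆ D') (z w : D) :
    kobayashi D' (inclusion h z) (inclusion h w) ≤ kobayashi D z w := by
  rw [kobayashi_eq_toReal_discDist, kobayashi_eq_toReal_discDist]
  exact ENNReal.toReal_mono (hD.discDist_ne_top z w) (discDist_anti h)

theorem one_lt_rank_real_Cn (hn : 2 ≤ n) : 1 < Module.rank ℝ (Cn n) := by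
  have hfinrank : Module.finrank ℝ (Cn n) = 2 * n := by
    rw [← Module.finrank_mul_finrank ℝ ℂ (Cn n), Complex.finrank_real_complex,
      finrank_euclideanSpace_fin]
  rw [← Module.finrank_eq_rank, hfinrank]
  exact_mod_cast (by lia : 1 < 2 * n)

theorem LinesAvoid.linesEscape (hL : LinesAvoid K) : LinesEscape K := by
  intro z hz
  obtain ⟨L, hzL, hL1, hLK⟩ := hL z hz
  obtain ⟨v, hv0, -⟩ := finrank_eq_one_iff'.1 hL1
  have hv : (v : Cn n) ≠ 0 := by simpa using hv0
  refine ⟨((‖(v : Cn n)‖ : ℂ)⁻¹) • (v : Cn n), norm_smul_inv_norm hv, fun c hc => ?_⟩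
  refine disjoint_left.1 hLK ?_ hc
  rw [smul_smul, add_comm]
  exact AffineSubspace.vadd_mem_of_mem_direction (L.direction.smul_mem _ v.2) hzL

theorem linesAvoid_of_convex (hn : 2 ≤ n) (hK : IsClosed K) (hc : Convex ℝ K) :
    LinesAvoid K := by
  intro z hz
  obtain ⟨f, u, hfK, hfz⟩ := RCLike.geometric_hahn_banach_closed_point (𝕜 := ℂ) hc hK hz
  obtain ⟨v, hfv, hv⟩ := Submodule.exists_mem_ne_zero_of_ne_bot
    (LinearMap.ker_ne_bot_of_finrank_lt (f := (f : Cn n →ₗ[ℂ] ℂ)) (by simp; lia))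
  refine ⟨AffineSubspace.mk' z (ℂ ∙ v), AffineSubspace.self_mem_mk' _ _, ?_, ?_⟩
  · rw [AffineSubspace.direction_mk', finrank_span_singleton hv]
  · refine disjoint_left.2 fun x hx hxK => ?_
    rw [SetLike.mem_coe, AffineSubspace.mem_mk', Submodule.mem_span_singleton] at hx
    obtain ⟨a, ha⟩ := hx
    have hfx : f x = f z := by
      rw [← sub_eq_zero, ← map_sub, ← vsub_eq_sub, ← ha, map_smul,
        show f v = 0 from hfv, smul_zero]
    exact (hfK x hxK).not_gt (hfx ▸ hfz)

theorem LinesAvoid.isDomainSet_diff (hL : LinesAvoid K) (hn : 2 ≤ n) (hG : IsDomainSet G)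
    (hK : IsCompact K) (hKG : K ⊆ G) : IsDomainSet (G \ K) :=
  ⟨hG.1.sdiff hK.isClosed,
    hL.linesEscape.isConnected_diff (one_lt_rank_real_Cn hn) hG.1 hG.2 hK hKG⟩

theorem LinesAvoid.exists_kobayashi_diff_le_add (hL : LinesAvoid K) (hG : IsDomainSet G)
    (hb : Bornology.IsBounded G) (hK : IsCompact K) (hKG : K ⊆ G) (hGK : IsDomainSet (G \ K)) :
    ∃ C : ℝ, ∀ z w : ↥(G \ K), kobayashi (G \ K) z w ≤
      kobayashi G (inclusion sdiff_subset z) (inclusion sdiff_subset w) + C := by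
  obtain ⟨C, hC, hle⟩ :=
    hL.linesEscape.exists_discDist_diff_le_add hG.1 hG.2.isPreconnected hb hK hKG hGK.2
  refine ⟨C.toReal, fun z w => ?_⟩
  rw [kobayashi_eq_toReal_discDist, kobayashi_eq_toReal_discDist]
  exact ENNReal.toReal_le_add (hle z z.2 w w.2)
    (hG.discDist_ne_top (inclusion sdiff_subset z) (inclusion sdiff_subset w)) hC

end Kobayashi

section RoughIsometry

variable {X Y : Type*} {d : X → X → ℝ} {d' : Y → Y → ℝ} {f : Y → X} {C : ℝ}

theorem IsDistance.comp_injective (hd : IsDistance d) (hf : Function.Injective f) :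
    IsDistance fun x y => d (f x) (f y) where
  nonneg _ _ := hd.nonneg _ _
  eq_zero_iff _ _ := (hd.eq_zero_iff _ _).trans hf.eq_iff
  symm _ _ := hd.symm _ _
  triangle _ _ _ := hd.triangle _ _ _

theorem IsDistance.isQuasiIsometry_of_le_of_le_add (hd' : IsDistance d') (hd : IsDistance d)
    (hle : ∀ x y, d (f x) (f y) ≤ d' x y) (hge : ∀ x y, d' x y ≤ d (f x) (f y) + C) :
    IsQuasiIsometry d' d f := by
  refine ⟨hd', hd, 1, max C 1, one_pos, by positivity, fun x y => ?_⟩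
  rw [inv_one, one_mul]
  constructor
  · linarith [hge x y, le_max_left C 1]
  · linarith [hle x y, le_max_right C 1]

theorem GromovHyperbolic.of_le_of_le_add (hd : GromovHyperbolic d) (hd' : IsDistance d')
    (hle : ∀ x y, d (f x) (f y) ≤ d' x y) (hge : ∀ x y, d' x y ≤ d (f x) (f y) + C) :
    GromovHyperbolic d' := by
  obtain ⟨-, C₀, hC₀⟩ := hd
  refine ⟨hd', C₀ + 3 * C, fun p q x w => ?_⟩
  have hupper : ∀ a b, gromovProduct d' a b w ≤ gromovProduct d (f a) (f b) (f w) + 2 * C :=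
    fun a b => by
      unfold gromovProduct
      linarith [hge a w, hge w b, hle a b]
  have hlower : gromovProduct d (f p) (f q) (f w) - C ≤ gromovProduct d' p q w := by
    unfold gromovProduct
    linarith [hle p w, hle w q, hge p q]
  have hmin : min (gromovProduct d' p x w) (gromovProduct d' x q w) ≤
      min (gromovProduct d (f p) (f x) (f w)) (gromovProduct d (f x) (f q) (f w)) + 2 * C := by
    rw [← min_add_add_right]
    exact min_le_min (hupper p x) (hupper x q)
  linarith [hC₀ (f p) (f q) (f x) (f w)]

end RoughIsometry

theorem proposition6 (n : ℕ) (hn : 2 ≤ n) :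
    (∀ G K : Set (Cn n), IsDomainSet G → Bornology.IsBounded G → IsCompact K → K ⊆ G →
      LinesAvoid K →
        IsDomainSet (G \ K) ∧
        QuasiIsometricallyEquivalent (kobayashi (G \ K))
          (fun z w : ↥(G \ K) => kobayashi G ⟨z.1, z.2.1⟩ ⟨w.1, w.2.1⟩) ∧
        (GromovHyperbolic (kobayashi G) → GromovHyperbolic (kobayashi (G \ K)))) ∧
    (∀ K : Set (Cn n), IsCompact K → Convex ℝ K → LinesAvoid K) := by
  refine ⟨fun G K hG hb hK hKG hL => ?_, fun K hK hc => linesAvoid_of_convex hn hK.isClosed hc⟩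
  have hGK := hL.isDomainSet_diff hn hG hK hKG
  have hdist := hGK.isDistance_kobayashi (hb.subset sdiff_subset)
  have hdistG := (hG.isDistance_kobayashi hb).comp_injective
    (inclusion_injective (sdiff_subset (t := K)))
  have hle := hGK.kobayashi_inclusion_le (sdiff_subset : G \ K ⊆ G)
  obtain ⟨C, hge⟩ := hL.exists_kobayashi_diff_le_add hG hb hK hKG hGK
  exact ⟨hGK, hdist.isQuasiIsometry_of_le_of_le_add hdistG hle hge,
    fun h => h.of_le_of_le_add hdist hle hge⟩
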